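/- Let $\mathcal T=(V,E,F)$ be a triangulation, as a simplicial complex, of a surface without boundary (compact or not, of any topological type), with every vertex of finite degree. Write $\deg(i)$ for the number of edges at the vertex $i$. A circle-packing metric is a function $r:V\to(0,\infty)$. Given an intersection angle $\Phi:E\to[0,\tfrac{\pi}{2}]$, a circle-packing metric $r$ assigns to each edge $\{i,j\}$ the hyperbolic length $$l_{ij}=\cosh^{-1}\!\big(\cosh r_i\cosh r_j+\cos\Phi_{ij}\,\sinh r_i\sinh r_j\big),$$ and its discrete Gaussian curvature (in hyperbolic background geometry) at the vertex $i$ is $$K_i=2\pi-\sum_{\{i,j,k\}\in F}\theta_i^{jk},$$ where $\theta_i^{jk}$ is the inner angle at $i$ of the hyperbolic triangle with side lengths $l_{ij},l_{ik},l_{jk}$. Assume that $\sup_{i\in V}\deg(i)<\infty$ and $\Phi\equiv 0$, and let $\varepsilon>0$. Then for every $\hat K:V\to\mathbb R$ with $$\Big(2-\frac{\deg(i)}{3}\Big)\pi+\varepsilon<\hat K_i<2\pi\qquad\text{for all } i\in V,$$ there is a circle-packing metric $r:V\to(0,\infty)$ whose hyperbolic discrete Gaussian curvature satisfies $K_i=\hat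 K_i$ for all $i\in V$. -/

import Mathlib

/-- A triangulation `(V, E, F)` of a surface (without boundary), as a simplicial complex: `E` is the
edge set of a simple graph on `V`, each face is a set of three pairwise adjacent vertices, and around
every vertex the faces close up to a cycle, i.e. the link of every vertex is a cycle graph through
all its neighbours. The surface may be compact or not, and need not be orientable, simply connected
or connected. Local finiteness is implied, since the links are finite. -/
structure SurfaceTriangulation (V : Type*) where
  /-- the 1-skeleton `(V, E)` -/
  graph : SimpleGraph V
  /-- the set `F` of faces, each given by its set of vertices -/
  faces : Set (Set V)
  face_card : ∀ f ∈ faces, f.ncard = 3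
  face_adj : ∀ f ∈ faces, ∀ i ∈ f, ∀ j ∈ f, i ≠ j → graph.Adj i j
  /-- the link of `i`, the graph on the neighbours of `i` in which `j` and `k` are joined when
  `{i, j, k}` is a face, is a cycle -/
  link_cycle : ∀ i : V, ∃ n : ℕ, 3 ≤ n ∧ Nonempty
    (SimpleGraph.fromRel (fun j k : graph.neighborSet i => ({i, (j : V), (k : V)} : Set V) ∈ faces)
      ≃g SimpleGraph.cycleGraph n)

namespace SurfaceTriangulation

variable {V : Type*}

theorem finite_neighborSet (T : SurfaceTriangulation V) (i : V) :
    Finite (T.graph.neighborSet i) := by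
  obtain ⟨n, -, ⟨e⟩⟩ := T.link_cycle i
  exact Finite.of_equiv _ e.toEquiv.symm

noncomputable instance (T : SurfaceTriangulation V) : T.graph.LocallyFinite := fun i =>
  haveI := T.finite_neighborSet i
  Fintype.ofFinite _

/-- The combinatorial degrees are uniformly bounded. -/
def BoundedDegree (T : SurfaceTriangulation V) : Prop :=
  ∃ N : ℕ, ∀ i : V, T.graph.degree i ≤ N

/-- The pairs `{j, k}` such that `{i, j, k}` is a face: they index the faces at the vertex `i`. -/
def oppositeEdges (T : SurfaceTriangulation V) (i : V) : Set (Sym2 V) :=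
  {e | ∃ j k : V, e = s(j, k) ∧ ({i, j, k} : Set V) ∈ T.faces}

theorem ne_of_face (T : SurfaceTriangulation V) {i j k : V} (h : ({i, j, k} : Set V) ∈ T.faces) :
    i ≠ j ∧ i ≠ k ∧ j ≠ k := by
  have h3 := T.face_card _ h
  have two : ∀ a b : V, ({a, b} : Set V).ncard ≤ 2 := fun a b =>
    (Set.ncard_insert_le a {b}).trans (by simp)
  refine ⟨?_, ?_, ?_⟩
  · rintro rfl
    rw [Set.insert_eq_of_mem (by simp)] at h3
    have := two i k
    omega
  · rintro rfl
    rw [Set.insert_eq_of_mem (by simp)] at h3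
    have := two j i
    omega
  · rintro rfl
    rw [Set.insert_eq_of_mem (a := j) (by simp)] at h3
    have := two i j
    omega

/-- Only finitely many faces meet at a vertex, so the sum of the angles there is a finite sum. -/
theorem finite_oppositeEdges (T : SurfaceTriangulation V) (i : V) : (T.oppositeEdges i).Finite := by
  have hf : (T.graph.neighborSet i).Finite := T.finite_neighborSet i
  refine ((hf.prod hf).image (fun p : V × V => s(p.1, p.2))).subset ?_
  rintro e ⟨j, k, rfl, h⟩
  obtain ⟨hij, hik, -⟩ := T.ne_of_face h
  exact ⟨(j, k), ⟨T.face_adj _ h i (by simp) j (by simp) hij,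
    T.face_adj _ h i (by simp) k (by simp) hik⟩, rfl⟩

end SurfaceTriangulation

/-- The length of an edge `e = {i, j}` for the radii `r` and the intersection angle `Φ e`, in
hyperbolic background geometry. -/
noncomputable def hypEdgeLength {V : Type*} (Φ : Sym2 V → ℝ) (r : V → ℝ) (i j : V) : ℝ :=
  Real.arcosh (Real.cosh (r i) * Real.cosh (r j)
    + Real.cos (Φ s(i, j)) * Real.sinh (r i) * Real.sinh (r j))

/-- The inner angle of a hyperbolic triangle between two sides of lengths `a` and `b`, where the third
side has length `c` (hyperbolic law of cosines). -/
noncomputable def hypTriangleAngle (a b c : ℝ) : ℝ :=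
  Real.arccos ((Real.cosh a * Real.cosh b - Real.cosh c) / (Real.sinh a * Real.sinh b))

theorem hypEdgeLength_comm {V : Type*} (Φ : Sym2 V → ℝ) (r : V → ℝ) (i j : V) :
    hypEdgeLength Φ r i j = hypEdgeLength Φ r j i := by
  unfold hypEdgeLength
  rw [Sym2.eq_swap]
  congr 1
  ring

theorem hypTriangleAngle_comm (a b c : ℝ) : hypTriangleAngle a b c = hypTriangleAngle b a c := by
  unfold hypTriangleAngle
  rw [mul_comm (Real.cosh a), mul_comm (Real.sinh a)]

/-- The inner angle at `i` of the face `{i, j, k}`, as a function of the pair `{j, k}`. -/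
noncomputable def hypInnerAngle {V : Type*} (Φ : Sym2 V → ℝ) (r : V → ℝ) (i : V) : Sym2 V → ℝ :=
  Sym2.lift ⟨fun j k => hypTriangleAngle (hypEdgeLength Φ r i j) (hypEdgeLength Φ r i k)
    (hypEdgeLength Φ r j k), fun j k => by
      dsimp only
      rw [hypTriangleAngle_comm, hypEdgeLength_comm Φ r j k]⟩

/-- A circle-packing metric: a positive radius at every vertex. -/
def IsCirclePackingMetric {V : Type*} (r : V → ℝ) : Prop :=
  ∀ i : V, 0 < r i

/-- The discrete Gaussian curvature at the vertex `i`, in hyperbolic background geometry: `2π` minus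
the sum of the inner angles at `i` of the faces at `i`. Only the values of the intersection angle `Φ`
on the edges of the triangulation matter. -/
noncomputable def SurfaceTriangulation.hypCurvature {V : Type*} (T : SurfaceTriangulation V)
    (Φ : Sym2 V → ℝ) (r : V → ℝ) (i : V) : ℝ :=
  2 * Real.pi - ∑ᶠ e ∈ T.oppositeEdges i, hypInnerAngle Φ r i e

open Real Filter Topology

/-! Since `Φ = 0` on edges, lengths are `r i + r j`, and the angle at `i` in a face increases with
the two other radii. It also tends to 0 as `r i → ∞`, uniformly in those radii. Perron's method
therefore applies to the angle sums `F i r`, with target `2π - Khat i`: the pointwise supremum of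
the radii with `F i r ≥ 2π - Khat i` solves the problem. The constant `ρ` is such a subsolution for
small `ρ`, as equal small circles are nearly Euclidean and give angles near `π / 3`; the slack `ε`
and the degree bound allow one `ρ` for all vertices. Subsolutions are bounded above at each vertex
because `Khat i < 2π`. Monotonicity in a vertex's own radius is never needed. -/

/-- **Perron's method** for a family of equations `F i r = A i`, where `F i` is monotone in the
coordinates other than `i` and continuous in the coordinate `i`: if the constant `ρ` is a
subsolution and subsolutions are bounded pointwise, then the supremum of the subsolutions is a
solution. -/
theorem exists_eq_of_subsolution {V : Type*} (F : V → (V → ℝ) → ℝ) (A M : V → ℝ) (ρ : ℝ)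
    (hmono : ∀ (i : V) (r s : V → ℝ), (∀ j, ρ ≤ r j) → r ≤ s → r i = s i → F i r ≤ F i s)
    (hcont : ∀ (i : V) (r : V → ℝ), (∀ j, ρ ≤ r j) → ∀ t, ρ ≤ t →
      ContinuousAt (fun t => F i (fun j => open Classical in if j = i then t else r j)) t)
    (hlow : ∀ i, A i ≤ F i (fun _ => ρ))
    (hup : ∀ (i : V) (r : V → ℝ), (∀ j, ρ ≤ r j) → A i ≤ F i r → r i ≤ M i) :
    ∃ r : V → ℝ, (∀ j, ρ ≤ r j) ∧ ∀ i, F i r = A i := by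
  classical
  let S : Set (V → ℝ) := {r | (∀ j, ρ ≤ r j) ∧ ∀ i, A i ≤ F i r}
  have hρ : (fun _ => ρ) ∈ S := ⟨fun _ => le_rfl, hlow⟩
  let R : V → ℝ := fun i => sSup ((fun r : V → ℝ => r i) '' S)
  have hbdd : ∀ i, BddAbove ((fun r : V → ℝ => r i) '' S) := by
    rintro i
    refine ⟨M i, ?_⟩
    rintro _ ⟨r, hr, rfl⟩
    exact hup i r hr.1 (hr.2 i)
  have hle : ∀ r ∈ S, r ≤ R := fun r hr i => le_csSup (hbdd i) ⟨r, hr, rfl⟩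
  have hRρ : ∀ j, ρ ≤ R j := fun j => hle _ hρ j
  have hself : ∀ i, (fun j => if j = i then R i else R j) = R := by
    intro i; funext j; split_ifs with h
    · rw [h]
    · rfl
  have hRsub : ∀ i, A i ≤ F i R := by
    intro i
    by_contra! hlt
    have hev : ∀ᶠ t in 𝓝 (R i), F i (fun j => if j = i then t else R j) < A i := by
      refine (hcont i R hRρ (R i) (hRρ i)).eventually_lt_const ?_
      simpa only [hself] using hlt
    obtain ⟨δ, hδ, hball⟩ := Metric.eventually_nhds_iff.1 hev
    -- A subsolution nearly attaining the supremum at `i`; raising its other coordinates to `R` can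
    -- only increase `F i`.
    obtain ⟨_, ⟨r, hr, rfl⟩, hri⟩ := exists_lt_of_lt_csSup (Set.Nonempty.image _ ⟨_, hρ⟩)
      (show R i - δ < sSup ((fun r : V → ℝ => r i) '' S) by
        change R i - δ < R i
        linarith)
    have hRi := hle r hr i
    have h1 : F i (fun j => if j = i then r i else R j) < A i := by
      apply hball
      rw [Real.dist_eq, abs_lt]
      constructor <;> simp only at hri <;> linarith
    have h2 : F i r ≤ F i (fun j => if j = i then r i else R j) := by
      refine hmono i _ _ hr.1 (fun j => ?_) (by simp)
      dsimp only
      split_ifs with h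
      · rw [h]
      · exact hle r hr j
    linarith [hr.2 i]
  refine ⟨R, hRρ, fun i => le_antisymm ?_ (hRsub i)⟩
  by_contra! hlt
  have hev : ∀ᶠ t in 𝓝 (R i), A i < F i (fun j => if j = i then t else R j) := by
    refine (hcont i R hRρ (R i) (hRρ i)).eventually_const_lt ?_
    simpa only [hself] using hlt
  obtain ⟨δ, hδ, hball⟩ := Metric.eventually_nhds_iff.1 hev
  -- If the inequality at `i` is strict, coordinate `i` can grow a little: continuity preserves it
  -- at `i`, monotonicity preserves the others. This contradicts the supremum.
  have hmem : (fun j => if j = i then R i + δ / 2 else R j) ∈ S := by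
    refine ⟨fun j => ?_, fun j => ?_⟩
    · dsimp only
      split_ifs
      · linarith [hRρ i]
      · exact hRρ j
    · by_cases hj : j = i
      · subst hj
        refine (hball ?_).le
        rw [Real.dist_eq, abs_lt]
        constructor <;> linarith
      · refine (hRsub j).trans (hmono j _ _ hRρ (fun k => ?_) (by simp [hj]))
        dsimp only
        split_ifs with h
        · rw [h]; linarith
        · exact le_rfl
  have := hle _ hmem i
  simp only [if_true] at this
  linarith

/-! ### Angles between mutually tangent hyperbolic circles -/

/-- The angle at the centre of the circle of radius `x` in the hyperbolic triangle formed by the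
centres of three mutually tangent circles of radii `x`, `y`, `z` (half-angle formula). -/
noncomputable def tangentAngle (x y z : ℝ) : ℝ :=
  arccos (1 - 2 * (sinh y / sinh (x + y)) * (sinh z / sinh (x + z)))

theorem hypEdgeLength_of_eq_zero {V : Type*} {Φ : Sym2 V → ℝ} {r : V → ℝ} {i j : V}
    (h : Φ s(i, j) = 0) (hi : 0 < r i) (hj : 0 < r j) :
    hypEdgeLength Φ r i j = r i + r j := by
  rw [hypEdgeLength, h, cos_zero, one_mul, ← cosh_add, arcosh_cosh (by positivity)]

theorem hypTriangleAngle_add {x y z : ℝ} (hx : 0 < x) (hy : 0 < y) (hz : 0 < z) :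
    hypTriangleAngle (x + y) (x + z) (y + z) = tangentAngle x y z := by
  have h1 : 0 < sinh (x + y) := sinh_pos_iff.2 (by positivity)
  have h2 : 0 < sinh (x + z) := sinh_pos_iff.2 (by positivity)
  have h3 := cosh_sub (x + y) (x + z)
  rw [show x + y - (x + z) = y - z by ring, cosh_sub] at h3
  rw [hypTriangleAngle, tangentAngle]
  congr 1
  field_simp
  rw [cosh_add y z]
  linarith

/-- After cross-multiplication the difference of the two sides is `sinh x * sinh (y' - y)`. -/
theorem sinh_div_sinh_add_mono {x y y' : ℝ} (hx : 0 < x) (hy : 0 < y) (h : y ≤ y') :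
    sinh y / sinh (x + y) ≤ sinh y' / sinh (x + y') := by
  have h1 : 0 < sinh (x + y) := sinh_pos_iff.2 (by positivity)
  have h2 : 0 < sinh (x + y') := sinh_pos_iff.2 (by linarith)
  rw [div_le_div_iff₀ h1 h2, sinh_add, sinh_add]
  have h3 : 0 ≤ sinh (y' - y) := sinh_nonneg_iff.2 (by linarith)
  have h4 : 0 < sinh x := sinh_pos_iff.2 hx
  rw [sinh_sub] at h3
  nlinarith

theorem sinh_div_sinh_add_nonneg {x y : ℝ} (hx : 0 < x) (hy : 0 < y) :
    0 ≤ sinh y / sinh (x + y) :=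
  div_nonneg (sinh_nonneg_iff.2 hy.le) (sinh_nonneg_iff.2 (by positivity))

theorem sinh_div_sinh_add_le {x y : ℝ} (hx : 0 < x) (hy : 0 < y) :
    sinh y / sinh (x + y) ≤ 1 / cosh x := by
  have h1 : 0 < sinh (x + y) := sinh_pos_iff.2 (by positivity)
  rw [div_le_div_iff₀ h1 (cosh_pos x), sinh_add]
  have h4 : 0 < sinh x := sinh_pos_iff.2 hx
  nlinarith [cosh_pos y]

theorem tangentAngle_mono {x y y' z z' : ℝ} (hx : 0 < x) (hy : 0 < y) (hz : 0 < z)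
    (hyy : y ≤ y') (hzz : z ≤ z') : tangentAngle x y z ≤ tangentAngle x y' z' := by
  apply antitone_arccos
  have := mul_le_mul (sinh_div_sinh_add_mono hx hy hyy) (sinh_div_sinh_add_mono hx hz hzz)
    (sinh_div_sinh_add_nonneg hx hz) (sinh_div_sinh_add_nonneg hx (hy.trans_le hyy))
  linarith

/-- The bound is independent of the neighbouring radii, so it limits the radius at a vertex whatever
the rest of the packing. -/
theorem tangentAngle_le {x y z : ℝ} (hx : 0 < x) (hy : 0 < y) (hz : 0 < z) :
    tangentAngle x y z ≤ arccos (1 - 2 * (1 / cosh x) * (1 / cosh x)) := by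
  apply antitone_arccos
  have := mul_le_mul (sinh_div_sinh_add_le hx hy) (sinh_div_sinh_add_le hx hz)
    (sinh_div_sinh_add_nonneg hx hz) (by positivity)
  linarith

theorem continuousAt_tangentAngle {x y z : ℝ} (hx : 0 < x) (hy : 0 < y) (hz : 0 < z) :
    ContinuousAt (fun t => tangentAngle t y z) x := by
  have h1 : sinh (x + y) ≠ 0 := (sinh_pos_iff.2 (by positivity)).ne'
  have h2 : sinh (x + z) ≠ 0 := (sinh_pos_iff.2 (by positivity)).ne'
  unfold tangentAngle
  refine continuous_arccos.continuousAt.comp ?_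
  fun_prop (disch := assumption)

theorem tendsto_tangentAngle_bound :
    Tendsto (fun x => arccos (1 - 2 * (1 / cosh x) * (1 / cosh x))) atTop (𝓝 0) := by
  have hc : Tendsto cosh atTop atTop := by
    refine tendsto_atTop_mono (f := fun x => exp x / 2) (fun x => ?_)
      (tendsto_exp_atTop.atTop_div_const two_pos)
    rw [cosh_eq]
    linarith [exp_pos (-x)]
  have h : Tendsto (fun x => 1 / cosh x) atTop (𝓝 0) := by
    simpa only [one_div, Function.comp_def] using tendsto_inv_atTop_zero.comp hc
  have h2 := (continuous_arccos.tendsto _).comp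
    (((h.const_mul 2).mul h).const_sub 1)
  simpa [Function.comp_def] using h2

theorem tangentAngle_self {x : ℝ} (hx : 0 < x) :
    tangentAngle x x x = arccos (1 - 1 / (2 * cosh x ^ 2)) := by
  have h : 0 < sinh x := sinh_pos_iff.2 hx
  have := cosh_pos x
  rw [tangentAngle, ← two_mul, sinh_two_mul]
  congr 1
  field_simp

theorem tendsto_tangentAngle_self :
    Tendsto (fun x => tangentAngle x x x) (𝓝[>] 0) (𝓝 (π / 3)) := by
  have h : Continuous fun x : ℝ => arccos (1 - 1 / (2 * cosh x ^ 2)) := by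
    have : ∀ x : ℝ, 2 * cosh x ^ 2 ≠ 0 := fun x => by have := cosh_pos x; positivity
    exact continuous_arccos.comp (by fun_prop (disch := exact this _))
  have h0 : arccos (1 - 1 / (2 * cosh 0 ^ 2)) = π / 3 := by
    rw [cosh_zero, ← arccos_cos (show 0 ≤ π / 3 by positivity) (by linarith [pi_pos]),
      cos_pi_div_three]
    norm_num
  have h1 := h.tendsto 0
  rw [h0] at h1
  refine (h1.mono_left nhdsWithin_le_nhds).congr' ?_
  filter_upwards [self_mem_nhdsWithin] with x hx
  exact (tangentAngle_self hx).symm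

/-! ### Faces at a vertex -/

namespace SurfaceTriangulation

variable {V : Type*}

theorem adj_of_face (T : SurfaceTriangulation V) {i j k : V}
    (h : ({i, j, k} : Set V) ∈ T.faces) :
    T.graph.Adj i j ∧ T.graph.Adj i k ∧ T.graph.Adj j k := by
  obtain ⟨h1, h2, h3⟩ := T.ne_of_face h
  exact ⟨T.face_adj _ h i (by simp) j (by simp) h1, T.face_adj _ h i (by simp) k (by simp) h2,
    T.face_adj _ h j (by simp) k (by simp) h3⟩

/-- As many faces as edges meet at a vertex. -/
theorem ncard_oppositeEdges (T : SurfaceTriangulation V) (i : V) :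
    (T.oppositeEdges i).ncard = T.graph.degree i := by
  classical
  obtain ⟨n, hn, ⟨e⟩⟩ := T.link_cycle i
  set L := SimpleGraph.fromRel
    (fun j k : T.graph.neighborSet i => ({i, (j : V), (k : V)} : Set V) ∈ T.faces) with hL
  have hdeg : T.graph.degree i = n := by
    rw [← SimpleGraph.card_neighborSet_eq_degree, Fintype.card_congr e.toEquiv, Fintype.card_fin]
  -- Faces at `i` are the edges of its link, a cycle, which has as many edges as vertices.
  have hopp : T.oppositeEdges i = Sym2.map Subtype.val '' L.edgeSet := by
    ext s
    constructor
    · rintro ⟨j, k, rfl, h⟩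
      obtain ⟨h1, h2, -⟩ := T.adj_of_face h
      refine ⟨s(⟨j, h1⟩, ⟨k, h2⟩), ?_, rfl⟩
      rw [SimpleGraph.mem_edgeSet, hL, SimpleGraph.fromRel_adj]
      exact ⟨fun hjk => (T.ne_of_face h).2.2 (congrArg Subtype.val hjk), Or.inl h⟩
    · rintro ⟨s, hs, rfl⟩
      induction s using Sym2.ind with
      | _ j k =>
        rw [SimpleGraph.mem_edgeSet, hL, SimpleGraph.fromRel_adj] at hs
        rcases hs.2 with h | h
        · exact ⟨j, k, rfl, h⟩
        · exact ⟨k, j, Sym2.eq_swap, h⟩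
  rw [hopp, Set.ncard_image_of_injective _ (Sym2.map.injective Subtype.val_injective), hdeg]
  have h1 : L.edgeSet.ncard = (SimpleGraph.cycleGraph n).edgeSet.ncard := by
    rw [← Nat.card_coe_set_eq, ← Nat.card_coe_set_eq]
    exact Nat.card_congr e.mapEdgeSet
  rw [h1]
  obtain ⟨m, rfl⟩ := Nat.exists_eq_add_of_le' hn
  have h2 := (SimpleGraph.cycleGraph (m + 3)).sum_degrees_eq_twice_card_edges
  simp only [SimpleGraph.cycleGraph_degree_three_le, Finset.sum_const, Finset.card_univ,
    Fintype.card_fin, smul_eq_mul] at h2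
  rw [← SimpleGraph.coe_edgeFinset, Set.ncard_coe_finset]
  omega

theorem hypInnerAngle_eq_tangentAngle (T : SurfaceTriangulation V) {Φ : Sym2 V → ℝ}
    (hΦ : ∀ e ∈ T.graph.edgeSet, Φ e = 0) {r : V → ℝ} (hr : ∀ i, 0 < r i) {i j k : V}
    (h : ({i, j, k} : Set V) ∈ T.faces) :
    hypInnerAngle Φ r i s(j, k) = tangentAngle (r i) (r j) (r k) := by
  obtain ⟨h1, h2, h3⟩ := T.adj_of_face h
  change hypTriangleAngle (hypEdgeLength Φ r i j) (hypEdgeLength Φ r i k)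
    (hypEdgeLength Φ r j k) = _
  rw [hypEdgeLength_of_eq_zero (hΦ _ h1) (hr i) (hr j),
    hypEdgeLength_of_eq_zero (hΦ _ h2) (hr i) (hr k),
    hypEdgeLength_of_eq_zero (hΦ _ h3) (hr j) (hr k), hypTriangleAngle_add (hr i) (hr j) (hr k)]

end SurfaceTriangulation

/-! ### Prescribing the curvature -/

theorem corollary4p4 {V : Type*} (T : SurfaceTriangulation V) (hT : T.BoundedDegree)
    (Φ : Sym2 V → ℝ) (hΦ : ∀ e ∈ T.graph.edgeSet, Φ e = 0)
    (ε : ℝ) (hε : 0 < ε) (Khat : V → ℝ)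
    (hK : ∀ i : V, (2 - (T.graph.degree i : ℝ) / 3) * Real.pi + ε < Khat i ∧
      Khat i < 2 * Real.pi) :
    ∃ r : V → ℝ, IsCirclePackingMetric r ∧ ∀ i : V, T.hypCurvature Φ r i = Khat i := by
  classical
  obtain ⟨N, hN⟩ := hT
  let O : V → Finset (Sym2 V) := fun i => (T.finite_oppositeEdges i).toFinset
  have hmem : ∀ {i e}, e ∈ O i → ∃ j k : V, e = s(j, k) ∧ ({i, j, k} : Set V) ∈ T.faces := by
    intro i e he
    exact (T.finite_oppositeEdges i).mem_toFinset.1 he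
  have hcard : ∀ i, (O i).card = T.graph.degree i := by
    intro i
    rw [← T.ncard_oppositeEdges i, Set.ncard_eq_toFinset_card _ (T.finite_oppositeEdges i)]
  let F : V → (V → ℝ) → ℝ := fun i r => ∑ e ∈ O i, hypInnerAngle Φ r i e
  have hcurv : ∀ r i, T.hypCurvature Φ r i = 2 * π - F i r := by
    intro r i
    rw [SurfaceTriangulation.hypCurvature,
      finsum_mem_eq_finite_toFinset_sum _ (T.finite_oppositeEdges i)]
  -- At most `N` angles, each short of `π / 3` by less than `ε / (N + 1)`, lose at most `ε` in
  -- total; the `+ 1` covers `N = 0`.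
  obtain ⟨ρ, hρ, hρN⟩ : ∃ ρ : ℝ, 0 < ρ ∧ π / 3 - ε / (N + 1) < tangentAngle ρ ρ ρ := by
    have h : π / 3 - ε / (N + 1) < π / 3 := by
      have : 0 < ε / (N + 1) := by positivity
      linarith
    obtain ⟨ρ, h1, h2⟩ := ((tendsto_tangentAngle_self.eventually_const_lt h).and
      self_mem_nhdsWithin).exists
    exact ⟨ρ, h2, h1⟩
  -- The target angle sum is positive, so it exceeds the angle bound times the degree at all large
  -- radii.
  have hM : ∀ i, ∃ M, ∀ x, M ≤ x → T.graph.degree i *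
      arccos (1 - 2 * (1 / cosh x) * (1 / cosh x)) < 2 * π - Khat i := by
    intro i
    refine eventually_atTop.1
      ((tendsto_tangentAngle_bound.const_mul (T.graph.degree i : ℝ)).eventually_lt_const ?_)
    linarith [(hK i).2]
  choose M hM using hM
  obtain ⟨r, hr, hrF⟩ := exists_eq_of_subsolution F (fun i => 2 * π - Khat i) M ρ
    (by
      intro i r s hr hrs hi
      refine Finset.sum_le_sum fun e he => ?_
      obtain ⟨j, k, rfl, h⟩ := hmem he
      have hr' : ∀ i, 0 < r i := fun i => hρ.trans_le (hr i)
      rw [T.hypInnerAngle_eq_tangentAngle hΦ hr' h,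
        T.hypInnerAngle_eq_tangentAngle hΦ (fun i => (hr' i).trans_le (hrs i)) h, ← hi]
      exact tangentAngle_mono (hr' i) (hr' j) (hr' k) (hrs j) (hrs k))
    (by
      intro i r hr t ht
      refine tendsto_finsetSum _ fun e he => ?_
      obtain ⟨j, k, rfl, h⟩ := hmem he
      obtain ⟨hij, hik, -⟩ := T.ne_of_face h
      have hr' : ∀ i, 0 < r i := fun i => hρ.trans_le (hr i)
      have ht' : 0 < t := hρ.trans_le ht
      have heq : ∀ u, 0 < u → tangentAngle u (r j) (r k) =
          hypInnerAngle Φ (fun j => if j = i then u else r j) i s(j, k) := by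
        intro u hu
        have hpos : ∀ l, 0 < (fun j => if j = i then u else r j) l := fun l => by
          dsimp only
          split_ifs
          exacts [hu, hr' l]
        rw [T.hypInnerAngle_eq_tangentAngle hΦ hpos h]
        simp [hij.symm, hik.symm]
      have hc := continuousAt_tangentAngle ht' (hr' j) (hr' k)
      refine (hc.congr ?_ : ContinuousAt _ t)
      filter_upwards [lt_mem_nhds ht'] with u hu using heq u hu)
    (by
      intro i
      have h1 : F i (fun _ => ρ) = T.graph.degree i * tangentAngle ρ ρ ρ := by
        rw [← hcard i, ← nsmul_eq_mul, ← Finset.sum_const]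
        refine Finset.sum_congr rfl fun e he => ?_
        obtain ⟨j, k, rfl, h⟩ := hmem he
        rw [T.hypInnerAngle_eq_tangentAngle hΦ (fun _ => hρ) h]
      rw [h1]
      have hd : (T.graph.degree i : ℝ) ≤ N + 1 := by exact_mod_cast (hN i).trans (Nat.le_succ N)
      have h2 : (T.graph.degree i : ℝ) * (ε / (N + 1)) ≤ ε := by
        rw [mul_div_assoc', div_le_iff₀ (by positivity)]
        nlinarith
      have h3 := mul_le_mul_of_nonneg_left hρN.le (Nat.cast_nonneg (α := ℝ) (T.graph.degree i))
      linarith [(hK i).1])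
    (by
      intro i r hr hA
      by_contra! hlt
      have h1 := hM i _ hlt.le
      have hr' : ∀ i, 0 < r i := fun i => hρ.trans_le (hr i)
      have h2 : F i r ≤ T.graph.degree i *
          arccos (1 - 2 * (1 / cosh (r i)) * (1 / cosh (r i))) := by
        rw [← hcard i, ← nsmul_eq_mul]
        refine Finset.sum_le_card_nsmul _ _ _ fun e he => ?_
        obtain ⟨j, k, rfl, h⟩ := hmem he
        rw [T.hypInnerAngle_eq_tangentAngle hΦ hr' h]
        exact tangentAngle_le (hr' i) (hr' j) (hr' k)
      linarith)
  refine ⟨r, fun i => hρ.trans_le (hr i), fun i => ?_⟩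
  rw [hcurv, hrF]
  ring
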